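/- All graphs are finite and simple. A graph $H$ is an $N\times N$ \emph{cubic mesh} if its maximum degree is $3$ and $H=Q_1\cup Q_2$, where each $Q_i$ ($i=1,2$) is a vertex-disjoint union of $N$ paths, the ends of the paths of $Q_i$ do not lie in $V(Q_{3-i})$, and every path of $Q_1$ intersects every path of $Q_2$ in exactly one common subpath (that is, their intersection is a nonempty path). A \emph{trigraph} is a simple graph some of whose edges are marked red; $N_T(x)$ denotes the set of all neighbours of $x$ in $T$ and $N^r_T(x)\subseteq N_T(x)$ the set of its red neighbours. \emph{Contracting} two distinct (possibly non-adjacent) vertices $x_1,x_2$ of $T$ replaces them by one new vertex $x_0$ and leaves the rest of $T$ unchanged, where in the resulting trigraph $T'$ $$N_{T'}(x_0)=(N_T(x_1)\cup N_T(x_2))\setminus\{x_1,x_2\},\qquad N^r_{T'}(x_0)=\big(N^r_T(x_1)\cup N^r_T(x_2)\cup(N_T(x_1)\mathbin{\Delta}N_T(x_2))\big)\setminus\{x_1,x_2\}.$$ The \emph{twin-width} of a graph $G$ is the least $d$ such that $G$, viewed as a trigraph without red edges, can be turned into a single vertex by successive contractions so that in every trigraph of the sequence (including the first and last) every vertex has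 at most $d$ red neighbours. \textbf{Theorem.} Let $t\ge 0$ be an integer and let $G$ be a finite simple graph that has no subgraph isomorphic to $K_{t,t}$ but has a (not necessarily induced) subgraph $H\subseteq G$ that is an $N\times N$ cubic mesh with $N=16\cdot(13t)^2$. Then the twin-width of $G$ is at least $3$. -/

import Mathlib

/-- A trigraph whose vertices are named by elements of `V`: a simple graph on the vertex set
`verts`, some of whose edges are marked as red. `graph` consists of all edges (black and red). -/
structure Trigraph (V : Type*) where
  verts : Set V
  graph : SimpleGraph V
  red : SimpleGraph V
  red_le : red ≤ graph
  mem_verts : ∀ ⦃u v : V⦄, graph.Adj u v → u ∈ verts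

namespace Trigraph

variable {V : Type*}

/-- An ordinary graph, as a trigraph with no red edges. -/
def ofGraph (G : SimpleGraph V) : Trigraph V where
  verts := Set.univ
  graph := G
  red := ⊥
  red_le := bot_le
  mem_verts := fun _ _ _ => Set.mem_univ _

/-- `T'` is obtained from `T` by contracting the (possibly non-adjacent) pair `x₁, x₂` into a
vertex named `x₀`. The name `x₀` may be any one not used by the remaining vertices. -/
structure IsContractionOf (T T' : Trigraph V) (x₁ x₂ x₀ : V) : Prop where
  left_mem : x₁ ∈ T.verts
  right_mem : x₂ ∈ T.verts
  ne : x₁ ≠ x₂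
  fresh : x₀ ∉ T.verts \ {x₁, x₂}
  verts_eq : T'.verts = insert x₀ (T.verts \ {x₁, x₂})
  neighborSet_eq : T'.graph.neighborSet x₀ =
    (T.graph.neighborSet x₁ ∪ T.graph.neighborSet x₂) \ {x₁, x₂}
  redNeighborSet_eq : T'.red.neighborSet x₀ =
    (T.red.neighborSet x₁ ∪ T.red.neighborSet x₂ ∪
      symmDiff (T.graph.neighborSet x₁) (T.graph.neighborSet x₂)) \ {x₁, x₂}
  adj_iff : ∀ u ∈ T.verts \ {x₁, x₂}, ∀ v ∈ T.verts \ {x₁, x₂},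
    (T'.graph.Adj u v ↔ T.graph.Adj u v)
  red_adj_iff : ∀ u ∈ T.verts \ {x₁, x₂}, ∀ v ∈ T.verts \ {x₁, x₂},
    (T'.red.Adj u v ↔ T.red.Adj u v)

/-- A sequence `S 0, …, S n` of successive contractions turning `T` into a single vertex. -/
structure IsContractionSequence (T : Trigraph V) {n : ℕ} (S : Fin (n + 1) → Trigraph V) :
    Prop where
  start : S 0 = T
  step : ∀ i : Fin n, ∃ x₁ x₂ x₀ : V, IsContractionOf (S i.castSucc) (S i.succ) x₁ x₂ x₀
  finish : ∃ x : V, (S (Fin.last n)).verts = {x}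

/-- The width of a sequence of trigraphs: the maximum red degree of any vertex in any of them. -/
noncomputable def width {n : ℕ} (S : Fin (n + 1) → Trigraph V) : ℕ∞ :=
  ⨆ (i : Fin (n + 1)) (v : V) (_ : v ∈ (S i).verts), ((S i).red.neighborSet v).encard

/-- The twin-width of a trigraph: the minimum width over all its contraction sequences
(`⊤` if it has none, which is the case for the empty and for infinite trigraphs only). -/
noncomputable def twinWidth (T : Trigraph V) : ℕ∞ :=
  ⨅ (n : ℕ) (S : Fin (n + 1) → Trigraph V) (_ : IsContractionSequence T S), width S

end Trigraph

namespace SimpleGraph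

/-- The twin-width of a graph. -/
noncomputable def twinWidth {V : Type*} (G : SimpleGraph V) : ℕ∞ :=
  (Trigraph.ofGraph G).twinWidth

/-- The subgraph `H` of `G` is, as a graph, an `N × N` cubic mesh: it has maximum degree `3` and
is the union of `N` pairwise disjoint paths `P i` (rows) and `N` pairwise disjoint paths `Q j`
(columns), where the ends of the rows lie on no column and vice versa, and where the intersection
(as graphs) of every row and every column is a path. -/
def Subgraph.IsCubicMesh {V : Type*} {G : SimpleGraph V} (H : G.Subgraph) (N : ℕ) : Prop :=
  (∀ v, (H.neighborSet v).encard ≤ 3) ∧ (∃ v, (H.neighborSet v).encard = 3) ∧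
  ∃ (a b c d : Fin N → V) (P : ∀ i, G.Walk (a i) (b i)) (Q : ∀ j, G.Walk (c j) (d j)),
    (∀ i, (P i).IsPath) ∧ (∀ j, (Q j).IsPath) ∧
    (∀ i i', i ≠ i' → (P i).support.Disjoint (P i').support) ∧
    (∀ j j', j ≠ j' → (Q j).support.Disjoint (Q j').support) ∧
    H = (⨆ i, (P i).toSubgraph) ⊔ (⨆ j, (Q j).toSubgraph) ∧
    (∀ i j, a i ∉ (Q j).support ∧ b i ∉ (Q j).support) ∧
    (∀ i j, c j ∉ (P i).support ∧ d j ∉ (P i).support) ∧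
    (∀ i j, ∃ (u v : V) (R : G.Walk u v),
      R.IsPath ∧ (P i).toSubgraph ⊓ (Q j).toSubgraph = R.toSubgraph)

end SimpleGraph

namespace SimpleGraph

/-! ### Mixed pairs of parts in graphs without `K_{t,t}`. -/

variable {V : Type*}

/-- The vertices adjacent to all vertices of `B`. -/
def commonNbrs (G : SimpleGraph V) (B : Set V) : Set V := {v | ∀ b ∈ B, G.Adj b v}

/-- Some vertex of `A` is adjacent to some vertex of `B`. -/
def Touch (G : SimpleGraph V) (A B : Set V) : Prop := ∃ a ∈ A, ∃ b ∈ B, G.Adj a b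

/-- The pair `A, B` is neither complete nor anticomplete. -/
def Mixed (G : SimpleGraph V) (A B : Set V) : Prop :=
  G.Touch A B ∧ ∃ a ∈ A, ∃ b ∈ B, ¬ G.Adj a b

lemma Touch.symm {G : SimpleGraph V} {A B : Set V} (h : G.Touch A B) : G.Touch B A := by
  obtain ⟨a, ha, b, hb, hab⟩ := h
  exact ⟨b, hb, a, ha, hab.symm⟩

lemma Mixed.symm {G : SimpleGraph V} {A B : Set V} (h : G.Mixed A B) : G.Mixed B A := by
  obtain ⟨h, a, ha, b, hb, hab⟩ := h
  exact ⟨h.symm, b, hb, a, ha, fun h => hab h.symm⟩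

lemma commonNbrs_anti (G : SimpleGraph V) {A B : Set V} (h : A ⊆ B) :
    G.commonNbrs B ⊆ G.commonNbrs A := fun _ hv a ha => hv a (h ha)

/-- A partition of the vertex set in which every part forms a mixed pair with at most two other
parts. -/
structure IsMixedTwoPartition (G : SimpleGraph V) (P : Set (Set V)) : Prop where
  disjoint : P.PairwiseDisjoint id
  cover : ∀ v, ∃ A ∈ P, v ∈ A
  le_two : ∀ A ∈ P, ∀ B ∈ P, ∀ C ∈ P, ∀ D ∈ P, B ≠ A → C ≠ A → D ≠ A →
    G.Mixed A B → G.Mixed A C → G.Mixed A D → B = C ∨ B = D ∨ C = D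

/-- `P'` arises from `P` by merging two parts. -/
def IsMerge (P P' : Set (Set V)) : Prop :=
  ∃ Y ∈ P, ∃ Y' ∈ P, Y ≠ Y' ∧ P' = insert (Y ∪ Y') (P \ {Y, Y'})

section Complete

variable [Finite V] {G : SimpleGraph V} {t : ℕ}

lemma isContained_of_complete {A B : Set V} (hA : t ≤ A.ncard) (hB : t ≤ B.ncard)
    (h : ∀ a ∈ A, ∀ b ∈ B, G.Adj a b) :
    (completeBipartiteGraph (Fin t) (Fin t)).IsContained G := by
  have emb : ∀ {S : Set V}, t ≤ S.ncard → ∃ f : Fin t ↪ V, ∀ i, f i ∈ S := by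
    intro S hS
    have : Fintype S := Fintype.ofFinite S
    rw [← Nat.card_coe_set_eq, Nat.card_eq_fintype_card] at hS
    obtain ⟨f⟩ := Function.Embedding.nonempty_of_card_le (α := Fin t) (β := S) (by simpa using hS)
    exact ⟨f.trans (Function.Embedding.subtype _), fun i => (f i).2⟩
  obtain ⟨f, hf⟩ := emb hA
  obtain ⟨g, hg⟩ := emb hB
  refine ⟨⟨⟨Sum.elim f g, ?_⟩, ?_⟩⟩
  · rintro (i | i) (j | j) hij
    · simp at hij
    · exact h _ (hf i) _ (hg j)
    · exact (h _ (hf j) _ (hg i)).symm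
    · simp at hij
  · refine f.injective.sumElim g.injective fun i j hij => ?_
    exact (h _ (hf i) _ (hg j)).ne hij

variable (hK : ¬ (completeBipartiteGraph (Fin t) (Fin t)).IsContained G)
include hK

lemma ncard_commonNbrs_lt {B : Set V} (hB : t ≤ B.ncard) : (G.commonNbrs B).ncard < t := by
  by_contra! h
  exact hK (isContained_of_complete hB h fun b hb v hv => hv b hb)

/-- A complete pair of this size would contain `K_{t,t}`. Thus for large parts a single edge already
counts towards the bound of two mixed partners. -/
lemma Touch.mixed {A B : Set V} (h : G.Touch A B) (hA : t ≤ A.ncard) (hB : t ≤ B.ncard) :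
    G.Mixed A B := by
  refine ⟨h, ?_⟩
  by_contra! h'
  exact hK (isContained_of_complete hA hB h')

end Complete

lemma mem_commonNbrs_or_mixed {G : SimpleGraph V} {A B : Set V} {a v : V} (ha : a ∈ A)
    (hv : v ∈ B) (h : G.Adj a v) : v ∈ G.commonNbrs A ∨ G.Mixed A B := by
  by_cases h' : v ∈ G.commonNbrs A
  · exact .inl h'
  · simp only [commonNbrs, Set.mem_ofPred_eq, not_forall] at h'
    obtain ⟨b, hb, hbv⟩ := h'
    exact .inr ⟨⟨a, ha, v, hv, h⟩, b, hb, v, hv, hbv⟩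

namespace IsMixedTwoPartition

variable {G : SimpleGraph V} {P : Set (Set V)}

/-- A part with two known mixed partners has no further ones. -/
lemma mem_commonNbrs (hP : G.IsMixedTwoPartition P) {A B C D : Set V} (hA : A ∈ P) (hB : B ∈ P)
    (hC : C ∈ P) (hD : D ∈ P) (hBA : B ≠ A) (hCA : C ≠ A) (hDA : D ≠ A) (hBC : B ≠ C)
    (hBD : B ≠ D) (hCD : C ≠ D) (mB : G.Mixed A B) (mC : G.Mixed A C) {a v : V} (ha : a ∈ A)
    (hv : v ∈ D) (h : G.Adj a v) : v ∈ G.commonNbrs A := by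
  refine (mem_commonNbrs_or_mixed ha hv h).resolve_right fun m => ?_
  rcases hP.le_two A hA B hB C hC D hD hBA hCA hDA mB mC m with h | h | h <;> contradiction

end IsMixedTwoPartition

/-! ### Linked paths. -/

/-- The sets `A` and `D` cannot be separated within `B ∪ C` by less than `4 * t` vertices that
include all common neighbours of `B` and of `C`. -/
def Conn (G : SimpleGraph V) (t : ℕ) (A B C D : Set V) : Prop :=
  ∀ Z U : Set V, Z.ncard < 4 * t → G.commonNbrs B ⊆ Z → G.commonNbrs C ⊆ Z → U ⊆ (B ∪ C) \ Z →
    (∀ a ∈ A \ Z, ∀ u ∈ (B ∪ C) \ Z, G.Adj a u → u ∈ U) →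
    (∀ u ∈ U, ∀ v ∈ (B ∪ C) \ Z, G.Adj u v → v ∈ U) → ∃ u ∈ U, ∃ d ∈ D \ Z, G.Adj u d

/-- A path of four large parts that carries a large linkage. -/
structure IsLinkedPath (G : SimpleGraph V) (t : ℕ) (P : Set (Set V)) (A B C D : Set V) :
    Prop where
  memA : A ∈ P
  memB : B ∈ P
  memC : C ∈ P
  memD : D ∈ P
  neAB : A ≠ B
  neAC : A ≠ C
  neAD : A ≠ D
  neBC : B ≠ C
  neBD : B ≠ D
  neCD : C ≠ D
  leA : t ≤ A.ncard
  leB : t ≤ B.ncard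
  leC : t ≤ C.ncard
  leD : t ≤ D.ncard
  touchAB : G.Touch A B
  touchBC : G.Touch B C
  touchCD : G.Touch C D
  conn : G.Conn t A B C D

/-- Complementation in `(B ∪ C) \ Z`: if a closed set holds all neighbours of `D` and none of `A`,
its complement is closed and holds all neighbours of `A` and none of `D`. -/
lemma Conn.symm {G : SimpleGraph V} {t : ℕ} {A B C D : Set V} (h : G.Conn t A B C D) :
    G.Conn t D C B A := by
  intro Z U hZ hC hB hU hD hcl
  by_contra! hno
  obtain ⟨u, ⟨hu, huU⟩, d, hd, hud⟩ := h Z (((B ∪ C) \ Z) \ U) hZ hB hC Set.sdiff_subset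
    (fun a ha u hu hau => ⟨hu, fun huU => hno u huU a ha hau.symm⟩)
    (fun u hu v hv huv => ⟨hv, fun hvU => hu.2 (hcl v hvU u (by rw [Set.union_comm]; exact hu.1)
      huv.symm)⟩)
  exact huU (hD d hd u (by rw [Set.union_comm]; exact hu) hud.symm)

lemma Conn.elim {G : SimpleGraph V} {t : ℕ} {A B C D : Set V} (h : G.Conn t A B C D) {p : Prop}
    (Z U : Set V) (hZ : Z.ncard < 4 * t) (hB : G.commonNbrs B ⊆ Z) (hC : G.commonNbrs C ⊆ Z)
    (hp : ∀ u ∈ U, ∀ d ∈ D \ Z, G.Adj u d → p) (hU : U ⊆ (B ∪ C) \ Z)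
    (hA : ∀ a ∈ A \ Z, ∀ u ∈ (B ∪ C) \ Z, G.Adj a u → u ∈ U)
    (hcl : ∀ u ∈ U, ∀ v ∈ (B ∪ C) \ Z, G.Adj u v → v ∈ U) : p := by
  obtain ⟨u, hu, d, hd, hud⟩ := h Z U hZ hB hC hU hA hcl
  exact hp u hu d hd hud

/-! ### Linked paths survive the undoing of a merge. -/

namespace IsLinkedPath

variable {G : SimpleGraph V} {t : ℕ} {P P' : Set (Set V)} {A B C D : Set V}

lemma symm (h : G.IsLinkedPath t P A B C D) : G.IsLinkedPath t P D C B A where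
  memA := h.memD
  memB := h.memC
  memC := h.memB
  memD := h.memA
  neAB := h.neCD.symm
  neAC := h.neBD.symm
  neAD := h.neAD.symm
  neBC := h.neBC.symm
  neBD := h.neAC.symm
  neCD := h.neAB.symm
  leA := h.leD
  leB := h.leC
  leC := h.leB
  leD := h.leA
  touchAB := h.touchCD.symm
  touchBC := h.touchBC.symm
  touchCD := h.touchAB.symm
  conn := h.conn.symm

variable [Finite V] (hK : ¬ (completeBipartiteGraph (Fin t) (Fin t)).IsContained G)
include hK

/-- `A` would be a third mixed partner of `C`, after `B` and `D`. -/
lemma not_touchAC (h : G.IsLinkedPath t P A B C D) (hP : G.IsMixedTwoPartition P) :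
    ¬ G.Touch A C := by
  intro hAC
  rcases hP.le_two C h.memC A h.memA B h.memB D h.memD h.neAC h.neBC h.neCD.symm
    (hAC.symm.mixed hK h.leC h.leA) (h.touchBC.symm.mixed hK h.leC h.leB)
    (h.touchCD.mixed hK h.leC h.leD) with e | e | e
  exacts [h.neAB e, h.neAD e, h.neBD e]

lemma not_touchBD (h : G.IsLinkedPath t P A B C D) (hP : G.IsMixedTwoPartition P) :
    ¬ G.Touch B D := fun hBD => h.symm.not_touchAC hK hP hBD.symm

/-- Splitting the first part of a linked path into a large piece touching the second part and
another piece. -/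
lemma split_fst_of_touch (hP : G.IsMixedTwoPartition P) {E E' : Set V}
    (hE : E ∈ P) (hE' : E' ∈ P) (hEE : E ≠ E') (hB : B ∈ P) (hC : C ∈ P) (hD : D ∈ P)
    (neAC : ¬ G.Touch (E ∪ E') C) (hEB : E ≠ B) (hEC : E ≠ C) (hED : E ≠ D) (hE'B : E' ≠ B)
    (hE'C : E' ≠ C) (hBC : B ≠ C) (hBD : B ≠ D) (hCD : C ≠ D) (leE : t ≤ E.ncard)
    (leB : t ≤ B.ncard) (leC : t ≤ C.ncard) (leD : t ≤ D.ncard) (tEB : G.Touch E B)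
    (tBC : G.Touch B C) (tCD : G.Touch C D) (conn : G.Conn t (E ∪ E') B C D) :
    G.IsLinkedPath t P E B C D := by
  refine ⟨hE, hB, hC, hD, hEB, hEC, hED, hBC, hBD, hCD, leE, leB, leC, leD, tEB, tBC, tCD, ?_⟩
  intro Z U hZ hBZ hCZ hU hEU hcl
  refine conn Z U hZ hBZ hCZ hU ?_ hcl
  rintro a ⟨ha | ha, haZ⟩ u hu hau
  · exact hEU a ⟨ha, haZ⟩ u hu hau
  -- `B` already has the mixed partners `E` and `C`, so a vertex of `E'` with a neighbour in `B` is
  -- a common neighbour of `B` and was deleted with `Z`.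
  · exfalso
    rcases hu.1 with huB | huC
    · exact haZ (hBZ (hP.mem_commonNbrs hB hE hC hE' hEB hBC.symm hE'B hEC hEE hE'C.symm
        (tEB.symm.mixed hK leB leE) (tBC.mixed hK leB leC) huB ha hau.symm))
    · exact neAC ⟨a, .inr ha, u, huC, hau⟩

omit [Finite V] hK in
-- Deleting the pieces of size below `t` costs at most `2 * (t - 1)`. Together with two sets of at
-- most `t - 1` common neighbours, this explains the bound `4 * t` in `Conn`.
lemma ncard_small {Y Y' : Set V} (ht : 0 < t) :
    ({v | (v ∈ Y ∧ Y.ncard < t) ∨ (v ∈ Y' ∧ Y'.ncard < t)} : Set V).ncard ≤ 2 * (t - 1) := by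
  have key : ∀ Y : Set V, ({v | v ∈ Y ∧ Y.ncard < t} : Set V).ncard ≤ t - 1 := by
    intro Y
    by_cases h : Y.ncard < t
    · simp only [h, and_true, Set.ofPred_mem_eq]; omega
    · simp [h]
  have := Set.ncard_union_le {v | v ∈ Y ∧ Y.ncard < t} {v | v ∈ Y' ∧ Y'.ncard < t}
  have h1 := key Y
  have h2 := key Y'
  rw [Set.ofPred_or]
  omega

lemma pos_of_not_isContained : 0 < t := by
  rcases Nat.eq_zero_or_pos t with rfl | h
  · exact (hK (isContained_of_complete (A := ∅) (B := ∅) (by simp) (by simp) (by simp))).elim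
  · exact h

/-- The union of the common neighbours of two large sets with a few further vertices. -/
lemma ncard_union_lt {S : Set V} (hB : t ≤ B.ncard) (hC : t ≤ C.ncard)
    (hS : S.ncard ≤ 2 * (t - 1)) :
    (G.commonNbrs B ∪ G.commonNbrs C ∪ S).ncard < 4 * t := by
  have h1 := ncard_commonNbrs_lt hK hB
  have h2 := ncard_commonNbrs_lt hK hC
  have h3 := Set.ncard_union_le (G.commonNbrs B) (G.commonNbrs C)
  have h4 := Set.ncard_union_le (G.commonNbrs B ∪ G.commonNbrs C) S
  omega

lemma split_fst {Y Y' : Set V} (h : G.IsLinkedPath t P' (Y ∪ Y') B C D)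
    (hP' : G.IsMixedTwoPartition P') (hP : G.IsMixedTwoPartition P) (hY : Y ∈ P) (hY' : Y' ∈ P)
    (hYY : Y ≠ Y') (hB : B ∈ P) (hC : C ∈ P) (hD : D ∈ P) (hYD : ∀ X ∈ ({B, C, D} : Set (Set V)),
      X ≠ Y ∧ X ≠ Y') :
    ∃ A, G.IsLinkedPath t P A B C D := by
  have nAC := h.not_touchAC hK hP'
  simp only [Set.mem_insert_iff, Set.mem_singleton_iff, forall_eq_or_imp, forall_eq] at hYD
  obtain ⟨⟨b1, b2⟩, ⟨c1, c2⟩, d1, d2⟩ := hYD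
  by_cases h1 : t ≤ Y.ncard ∧ G.Touch Y B
  · exact ⟨Y, split_fst_of_touch hK hP hY hY' hYY hB hC hD nAC b1.symm c1.symm d1.symm b2.symm
      c2.symm h.neBC h.neBD h.neCD h1.1 h.leB h.leC h.leD h1.2 h.touchBC h.touchCD h.conn⟩
  by_cases h2 : t ≤ Y'.ncard ∧ G.Touch Y' B
  · rw [Set.union_comm] at nAC h
    exact ⟨Y', split_fst_of_touch hK hP hY' hY hYY.symm hB hC hD nAC b2.symm c2.symm d2.symm
      b1.symm c1.symm h.neBC h.neBD h.neCD h2.1 h.leB h.leC h.leD h2.2 h.touchBC h.touchCD h.conn⟩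
  exfalso
  have ht := pos_of_not_isContained hK
  -- If no piece is both large and in touch with `B`, deleting the small pieces leaves no edge from
  -- `Y ∪ Y'` to `B ∪ C`, and the empty set violates `Conn`.
  refine h.conn.elim _ ∅ (ncard_union_lt hK h.leB h.leC (ncard_small (Y := Y) (Y' := Y') ht))
    (Set.subset_union_left.trans Set.subset_union_left)
    (Set.subset_union_right.trans Set.subset_union_left) (fun _ hu => hu.elim)
    (Set.empty_subset _) ?_ (by simp)
  rintro a ⟨ha, haZ⟩ u ⟨hu, -⟩ hau
  exfalso
  have haZ' : ¬ ((a ∈ Y ∧ Y.ncard < t) ∨ (a ∈ Y' ∧ Y'.ncard < t)) := fun h => haZ (.inr h)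
  push Not at haZ'
  rcases hu with hu | hu
  · rcases ha with ha | ha
    · exact h1 ⟨haZ'.1 ha, a, ha, u, hu, hau⟩
    · exact h2 ⟨haZ'.2 ha, a, ha, u, hu, hau⟩
  · exact nAC ⟨a, ha, u, hu, hau⟩

/-- Splitting the second part of a linked path into a large piece touching the third part and
another piece. -/
lemma split_snd_of_touch {E E' : Set V} (h : G.IsLinkedPath t P' A (E ∪ E') C D)
    (hP' : G.IsMixedTwoPartition P') (hP : G.IsMixedTwoPartition P)
    (hA : A ∈ P) (hE : E ∈ P) (hE' : E' ∈ P) (hEE : E ≠ E') (hC : C ∈ P) (hD : D ∈ P)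
    (hEA : E ≠ A) (hE'A : E' ≠ A) (hEC : E ≠ C) (hE'C : E' ≠ C) (hED : E ≠ D) (hE'D : E' ≠ D)
    (leE : t ≤ E.ncard) (tEC : G.Touch E C) :
    ∃ A B, G.IsLinkedPath t P A B C D := by
  have nAC := h.not_touchAC hK hP'
  have nBD := h.not_touchBD hK hP'
  have ht := pos_of_not_isContained hK
  have hE'S : ∀ u ∈ E', ∀ c ∈ C, G.Adj u c → u ∈ G.commonNbrs C := fun u hu c hc huc =>
    hP.mem_commonNbrs hC hE hD hE' hEC h.neCD.symm hE'C hED hEE hE'D.symm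
      (tEC.symm.mixed hK h.leC leE) (h.touchCD.mixed hK h.leC h.leD) hc hu huc.symm
  by_cases tAE : G.Touch A E
  · refine ⟨A, E, hA, hE, hC, hD, hEA.symm, h.neAC, h.neAD, hEC, hED, h.neCD, h.leA, leE, h.leC,
      h.leD, tAE, tEC, h.touchCD, ?_⟩
    have hE'E : ∀ u ∈ E', ∀ c ∈ E, G.Adj u c → u ∈ G.commonNbrs E := fun u hu c hc huc =>
      hP.mem_commonNbrs hE hA hC hE' hEA.symm hEC.symm hEE.symm h.neAC hE'A.symm hE'C.symm
        (tAE.symm.mixed hK leE h.leA) (tEC.mixed hK leE h.leC) hc hu huc.symm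
    intro Z U hZ hEZ hCZ hU hAU hcl
    -- Adding `E' \ Z` to `U` is harmless: `E` and `C` have their two mixed partners already, so
    -- edges from `E'` to them start in `Z`, and `E'` does not touch `D`.
    refine h.conn.elim Z (U ∪ E' \ Z) hZ
      ((G.commonNbrs_anti Set.subset_union_left).trans hEZ) hCZ ?_ ?_ ?_ ?_
    · intro u hu d hd hud
      rcases hu with hu | hu
      · exact ⟨u, hu, d, hd, hud⟩
      · exact (nBD ⟨u, .inr hu.1, d, hd.1, hud⟩).elim
    · rintro x (hx | hx)
      · exact ⟨(hU hx).1.imp .inl id, (hU hx).2⟩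
      · exact ⟨.inl (.inr hx.1), hx.2⟩
    · rintro a ha u ⟨(hu | hu) | hu, huZ⟩ hau
      · exact .inl (hAU a ha u ⟨.inl hu, huZ⟩ hau)
      · exact .inr ⟨hu, huZ⟩
      · exact .inl (hAU a ha u ⟨.inr hu, huZ⟩ hau)
    · rintro u hu v ⟨(hv | hv) | hv, hvZ⟩ huv
      · rcases hu with hu | hu
        · exact .inl (hcl u hu v ⟨.inl hv, hvZ⟩ huv)
        · exact (hu.2 (hEZ (hE'E u hu.1 v hv huv))).elim
      · exact .inr ⟨hv, hvZ⟩
      · rcases hu with hu | hu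
        · exact .inl (hcl u hu v ⟨.inr hv, hvZ⟩ huv)
        · exact (hu.2 (hCZ (hE'S u hu.1 v hv huv))).elim
  -- Now everything leaving `A` enters `E'` first, so `E'` replaces `A` as the first part. Were it
  -- small or not touching `E`, `A` would be separated from `D`.
  · have leE' : t ≤ E'.ncard := by
      by_contra! hlt
      refine h.conn.elim (G.commonNbrs (E ∪ E') ∪ G.commonNbrs C ∪ E') ∅
        (ncard_union_lt hK h.leB h.leC (by omega))
        (Set.subset_union_left.trans Set.subset_union_left)
        (Set.subset_union_right.trans Set.subset_union_left) (fun _ hu => hu.elim)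
        (Set.empty_subset _) ?_ (by simp)
      rintro a ⟨ha, -⟩ u ⟨(hu | hu) | hu, huZ⟩ hau
      · exact (tAE ⟨a, ha, u, hu, hau⟩).elim
      · exact (huZ (.inr hu)).elim
      · exact (nAC ⟨a, ha, u, hu, hau⟩).elim
    have tE'E : G.Touch E' E := by
      by_contra hn
      refine h.conn.elim (G.commonNbrs (E ∪ E') ∪ G.commonNbrs C ∪ ∅)
        (E' \ (G.commonNbrs (E ∪ E') ∪ G.commonNbrs C ∪ ∅))
        (ncard_union_lt hK h.leB h.leC (by simp))
        (Set.subset_union_left.trans Set.subset_union_left)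
        (Set.subset_union_right.trans Set.subset_union_left)
        (fun u hu d hd hud => nBD ⟨u, .inr hu.1, d, hd.1, hud⟩)
        (Set.sdiff_subset_sdiff_left (Set.subset_union_right.trans Set.subset_union_left)) ?_ ?_
      · rintro a ⟨ha, -⟩ u ⟨(hu | hu) | hu, huZ⟩ hau
        · exact (tAE ⟨a, ha, u, hu, hau⟩).elim
        · exact ⟨hu, huZ⟩
        · exact (nAC ⟨a, ha, u, hu, hau⟩).elim
      · rintro u ⟨hu, huZ⟩ v ⟨(hv | hv) | hv, hvZ⟩ huv
        · exact (hn ⟨u, hu, v, hv, huv⟩).elim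
        · exact ⟨hv, hvZ⟩
        · exact (huZ (.inl (.inr (hE'S u hu v hv huv)))).elim
    refine ⟨E', E, hE', hE, hC, hD, hEE.symm, hE'C, hE'D, hEC, hED, h.neCD, leE', leE, h.leC,
      h.leD, tE'E, tEC, h.touchCD, ?_⟩
    intro Z U hZ hEZ hCZ hU hE'U hcl
    refine h.conn.elim Z (U ∪ E' \ Z) hZ
      ((G.commonNbrs_anti Set.subset_union_left).trans hEZ) hCZ ?_ ?_ ?_ ?_
    · intro u hu d hd hud
      rcases hu with hu | hu
      · exact ⟨u, hu, d, hd, hud⟩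
      · exact (nBD ⟨u, .inr hu.1, d, hd.1, hud⟩).elim
    · rintro x (hx | hx)
      · exact ⟨(hU hx).1.imp .inl id, (hU hx).2⟩
      · exact ⟨.inl (.inr hx.1), hx.2⟩
    · rintro a ⟨ha, -⟩ u ⟨(hu | hu) | hu, huZ⟩ hau
      · exact (tAE ⟨a, ha, u, hu, hau⟩).elim
      · exact .inr ⟨hu, huZ⟩
      · exact (nAC ⟨a, ha, u, hu, hau⟩).elim
    · rintro u hu v ⟨hv, hvZ⟩ huv
      have : v ∈ E' ∨ v ∈ E ∪ C := by
        rcases hv with (hv | hv) | hv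
        exacts [.inr (.inl hv), .inl hv, .inr (.inr hv)]
      rcases this with hv | hv
      · exact .inr ⟨hv, hvZ⟩
      · rcases hu with hu | hu
        · exact .inl (hcl u hu v ⟨hv, hvZ⟩ huv)
        · exact .inl (hE'U u hu v ⟨hv, hvZ⟩ huv)

lemma split_snd {Y Y' : Set V} (h : G.IsLinkedPath t P' A (Y ∪ Y') C D)
    (hP' : G.IsMixedTwoPartition P') (hP : G.IsMixedTwoPartition P) (hY : Y ∈ P) (hY' : Y' ∈ P)
    (hYY : Y ≠ Y') (hA : A ∈ P) (hC : C ∈ P) (hD : D ∈ P) (hYD : ∀ X ∈ ({A, C, D} : Set (Set V)),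
      X ≠ Y ∧ X ≠ Y') :
    ∃ A B, G.IsLinkedPath t P A B C D := by
  have nAC := h.not_touchAC hK hP'
  have nBD := h.not_touchBD hK hP'
  simp only [Set.mem_insert_iff, Set.mem_singleton_iff, forall_eq_or_imp, forall_eq] at hYD
  obtain ⟨⟨a1, a2⟩, ⟨c1, c2⟩, d1, d2⟩ := hYD
  by_cases h1 : t ≤ Y.ncard ∧ G.Touch Y C
  · exact split_snd_of_touch hK h hP' hP hA hY hY' hYY hC hD a1.symm a2.symm c1.symm c2.symm
      d1.symm d2.symm h1.1 h1.2
  by_cases h2 : t ≤ Y'.ncard ∧ G.Touch Y' C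
  · rw [Set.union_comm] at h
    exact split_snd_of_touch hK h hP' hP hA hY' hY hYY.symm hC hD a2.symm a1.symm c2.symm c1.symm
      d2.symm d1.symm h2.1 h2.2
  exfalso
  have ht := pos_of_not_isContained hK
  set S : Set V := {v | (v ∈ Y ∧ Y.ncard < t) ∨ (v ∈ Y' ∧ Y'.ncard < t)}
  -- Small pieces lie in the deleted set and large ones do not touch `C`, so what remains of `Y ∪
  -- Y'` is closed; it does not touch `D`.
  refine h.conn.elim (G.commonNbrs (Y ∪ Y') ∪ G.commonNbrs C ∪ S)
    ((Y ∪ Y') \ (G.commonNbrs (Y ∪ Y') ∪ G.commonNbrs C ∪ S))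
    (ncard_union_lt hK h.leB h.leC (ncard_small ht))
    (Set.subset_union_left.trans Set.subset_union_left)
    (Set.subset_union_right.trans Set.subset_union_left)
    (fun u hu d hd hud => nBD ⟨u, hu.1, d, hd.1, hud⟩)
    (Set.sdiff_subset_sdiff_left Set.subset_union_left) ?_ ?_
  · rintro a ⟨ha, -⟩ u ⟨hu | hu, huZ⟩ hau
    · exact ⟨hu, huZ⟩
    · exact (nAC ⟨a, ha, u, hu, hau⟩).elim
  · rintro u ⟨hu, huZ⟩ v ⟨hv | hv, hvZ⟩ huv
    · exact ⟨hv, hvZ⟩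
    · have huZ' : ¬ ((u ∈ Y ∧ Y.ncard < t) ∨ (u ∈ Y' ∧ Y'.ncard < t)) := fun h => huZ (.inr h)
      push Not at huZ'
      rcases hu with hu | hu
      · exact (h1 ⟨huZ'.1 hu, u, hu, v, hv, huv⟩).elim
      · exact (h2 ⟨huZ'.2 hu, u, hu, v, hv, huv⟩).elim

/-- Linked paths persist when a merge is undone. -/
lemma exists_of_isMerge (h : G.IsLinkedPath t P' A B C D) (hP' : G.IsMixedTwoPartition P')
    (hP : G.IsMixedTwoPartition P) (hm : IsMerge P P') :
    ∃ A B C D, G.IsLinkedPath t P A B C D := by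
  obtain ⟨Y, hY, Y', hY', hYY, rfl⟩ := hm
  have old : ∀ X ∈ insert (Y ∪ Y') (P \ {Y, Y'}), X ≠ Y ∪ Y' → X ∈ P ∧ X ≠ Y ∧ X ≠ Y' := by
    rintro X (hX | hX) hne
    · exact (hne hX).elim
    · simpa using hX
  by_cases eA : A = Y ∪ Y'
  · subst eA
    have b := old B h.memB h.neAB.symm
    have c := old C h.memC h.neAC.symm
    have d := old D h.memD h.neAD.symm
    obtain ⟨A, hA⟩ := split_fst hK h hP' hP hY hY' hYY b.1 c.1 d.1 (by simp [b.2, c.2, d.2])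
    exact ⟨_, _, _, _, hA⟩
  by_cases eD : D = Y ∪ Y'
  · subst eD
    have a := old A h.memA h.neAD
    have b := old B h.memB h.neBD
    have c := old C h.memC h.neCD
    obtain ⟨A, hA⟩ := split_fst hK h.symm hP' hP hY hY' hYY c.1 b.1 a.1 (by simp [a.2, b.2, c.2])
    exact ⟨_, _, _, _, hA⟩
  have a := old A h.memA eA
  have d := old D h.memD eD
  by_cases eB : B = Y ∪ Y'
  · subst eB
    have c := old C h.memC h.neBC.symm
    obtain ⟨A, B, hA⟩ := split_snd hK h hP' hP hY hY' hYY a.1 c.1 d.1 (by simp [a.2, c.2, d.2])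
    exact ⟨_, _, _, _, hA⟩
  by_cases eC : C = Y ∪ Y'
  · subst eC
    have b := old B h.memB h.neBC
    obtain ⟨A, B, hA⟩ := split_snd hK h.symm hP' hP hY hY' hYY d.1 b.1 a.1
      (by simp [a.2, b.2, d.2])
    exact ⟨_, _, _, _, hA⟩
  exact ⟨A, B, C, D, { h with
    memA := a.1, memB := (old B h.memB eB).1, memC := (old C h.memC eC).1, memD := d.1 }⟩

/-- Two single vertices never form a mixed pair. -/
lemma not_of_subsingleton (h : G.IsLinkedPath t P A B C D) (hA : A.Subsingleton)
    (hB : B.Subsingleton) : False := by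
  obtain ⟨⟨a, ha, b, hb, hab⟩, a', ha', b', hb', hn⟩ := h.touchAB.mixed hK h.leA h.leB
  exact hn (hA ha ha' ▸ hB hb hb' ▸ hab)

end IsLinkedPath

/-! ### Parts that meet many members of a crossing family. -/

/-- The indices of the members of the family `R` that meet `X`. -/
def hits {ι : Type*} (R : ι → Set V) (X : Set V) : Set ι := {i | (R i ∩ X).Nonempty}

section hits

variable {ι : Type*} (R : ι → Set V)

lemma hits_union (X Y : Set V) : hits R (X ∪ Y) = hits R X ∪ hits R Y := by
  ext i
  simp [hits, Set.inter_union_distrib_left, Set.union_nonempty]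

lemma ncard_hits_union_le (X Y : Set V) :
    (hits R (X ∪ Y)).ncard ≤ (hits R X).ncard + (hits R Y).ncard := by
  rw [hits_union]
  exact Set.ncard_union_le _ _

variable {R}

lemma ncard_hits_le [Finite V] (hR : Pairwise fun i j => Disjoint (R i) (R j)) (X : Set V) :
    (hits R X).ncard ≤ X.ncard := by
  choose f hf using fun i : hits R X => i.2
  rw [← Nat.card_coe_set_eq, ← Nat.card_coe_set_eq]
  refine Nat.card_le_card_of_injective (fun i => (⟨f i, (hf i).2⟩ : X)) fun i j hij => ?_
  by_contra hne
  have hij' : f i = f j := congrArg Subtype.val hij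
  exact Set.disjoint_left.1 (hR fun h => hne (Subtype.ext h)) (hf i).1 (hij' ▸ (hf j).1)

end hits

variable [Finite V] {G : SimpleGraph V} {t : ℕ} {P : Set (Set V)}
  (hK : ¬ (completeBipartiteGraph (Fin t) (Fin t)).IsContained G)

omit [Finite V] in
lemma IsMixedTwoPartition.mem_of_adj (hP : G.IsMixedTwoPartition P) {A B C : Set V} (hA : A ∈ P)
    (hB : B ∈ P) (hC : C ∈ P) (hAB : A ≠ B) (hCB : C ≠ B) (hAC : A ≠ C) (mA : G.Mixed B A)
    (mC : G.Mixed B C) {u v : V} (hu : u ∈ B) (huv : G.Adj u v) :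
    v ∈ A ∨ v ∈ B ∨ v ∈ C ∨ v ∈ G.commonNbrs B := by
  obtain ⟨X, hX, hvX⟩ := hP.cover v
  by_cases h1 : A = X
  · exact .inl (h1 ▸ hvX)
  by_cases h2 : B = X
  · exact .inr (.inl (h2 ▸ hvX))
  by_cases h3 : C = X
  · exact .inr (.inr (.inl (h3 ▸ hvX)))
  exact .inr (.inr (.inr (hP.mem_commonNbrs hB hA hC hX hAB hCB (Ne.symm h2) hAC h1 h3 mA mC hu hvX
    huv)))

omit [Finite V] in
/-- If all mixed partners of `B` are in `F`, then the neighbours of `B` are in `B`, in a member of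
`F`, or adjacent to all of `B`. -/
lemma IsMixedTwoPartition.mem_of_adj' (hP : G.IsMixedTwoPartition P) {B : Set V}
    {F : Set (Set V)} (hF : ∀ X ∈ P, X ≠ B → G.Mixed B X → X ∈ F) {u v : V} (hu : u ∈ B)
    (huv : G.Adj u v) : v ∈ B ∨ v ∈ G.commonNbrs B ∨ ∃ X ∈ F, v ∈ X := by
  obtain ⟨X, hX, hvX⟩ := hP.cover v
  by_cases h2 : X = B
  · exact .inl (h2 ▸ hvX)
  rcases mem_commonNbrs_or_mixed hu hvX huv with h | h
  · exact .inr (.inl h)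
  · exact .inr (.inr ⟨X, hF X hX h2 h, hvX⟩)

include hK

/-- Either there is a linked path, or what can be reached from `A` through the part `B` outside a
small set lies within `B` and one further part. -/
lemma exists_isLinkedPath_or_closed (hP : G.IsMixedTwoPartition P) {A B : Set V} (hA : A ∈ P)
    (hB : B ∈ P) (leA : t ≤ A.ncard) :
    (∃ A B C D, G.IsLinkedPath t P A B C D) ∨ ∃ C ∈ P, ∃ Z U : Set V, Z.ncard < 4 * t ∧
      U ⊆ B ∪ C ∧ (∀ a ∈ A \ Z, ∀ b ∈ B \ Z, G.Adj a b → b ∈ A ∨ b ∈ G.commonNbrs A ∨ b ∈ U) ∧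
      ∀ u ∈ U, ∀ v, G.Adj u v → v ∈ A ∨ v ∈ U ∨ v ∈ Z := by
  have ht := IsLinkedPath.pos_of_not_isContained hK
  -- Mixed partners are followed outwards from `A` through `B`, `C`, `D`. If the next one is missing
  -- or small, the exploration stops there, with a small part put into `Z`. When no second part is
  -- needed, `A` or `B` serves as filler for `C`.
  by_cases hAB : A = B
  · exact .inr ⟨A, hA, ∅, ∅, by simpa, by simp, fun _ _ b hb _ => .inl (hAB ▸ hb.1), by simp⟩
  by_cases mAB : G.Mixed A B
  swap
  · refine .inr ⟨A, hA, ∅, ∅, by simpa, by simp, fun a ha b hb hab => ?_, by simp⟩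
    exact .inr (.inl ((mem_commonNbrs_or_mixed ha.1 hb.1 hab).resolve_right mAB))
  by_cases leB : t ≤ B.ncard
  swap
  · refine .inr ⟨A, hA, B, ∅, by omega, by simp, fun a ha b hb hab => ?_, by simp⟩
    exact (hb.2 hb.1).elim
  have hSB := ncard_commonNbrs_lt hK leB
  by_cases hC : ∃ C ∈ P, C ≠ A ∧ C ≠ B ∧ G.Mixed B C
  swap
  · push Not at hC
    refine .inr ⟨B, hB, G.commonNbrs B, B, by omega, by simp, fun a _ b hb _ => .inr (.inr hb.1),
      fun u hu v huv => ?_⟩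
    rcases hP.mem_of_adj' (F := {A}) (fun X hX hXB m => by
      by_contra hXA; exact hC X hX hXA hXB m) hu huv with h | h | ⟨X, rfl, h⟩
    exacts [.inr (.inl h), .inr (.inr h), .inl h]
  obtain ⟨C, hC, hCA, hCB, mBC⟩ := hC
  have nbrB := @IsMixedTwoPartition.mem_of_adj V G P hP A B C hA hB hC hAB hCB hCA.symm mAB.symm mBC
  by_cases leC : t ≤ C.ncard
  swap
  · refine .inr ⟨B, hB, G.commonNbrs B ∪ C, B, ?_, by simp, fun a _ b hb _ => .inr (.inr hb.1),
      fun u hu v huv => ?_⟩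
    · have := Set.ncard_union_le (G.commonNbrs B) C
      omega
    rcases nbrB hu huv with h | h | h | h
    exacts [.inl h, .inr (.inl h), .inr (.inr (.inr h)), .inr (.inr (.inl h))]
  by_cases hD : ∃ D ∈ P, D ≠ A ∧ D ≠ B ∧ D ≠ C ∧ G.Mixed C D
  swap
  · push Not at hD
    refine .inr ⟨C, hC, G.commonNbrs B ∪ G.commonNbrs C ∪ ∅, B ∪ C,
      IsLinkedPath.ncard_union_lt hK leB leC (by simp), subset_rfl,
      fun a _ b hb _ => .inr (.inr (.inl hb.1)), ?_⟩
    rintro u (hu | hu) v huv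
    · rcases nbrB hu huv with h | h | h | h
      exacts [.inl h, .inr (.inl (.inl h)), .inr (.inl (.inr h)), .inr (.inr (.inl (.inl h)))]
    · rcases hP.mem_of_adj' (F := {A, B}) (fun X hX hXC m => by
        by_contra hX'
        simp only [Set.mem_insert_iff, Set.mem_singleton_iff, not_or] at hX'
        exact hD X hX hX'.1 hX'.2 hXC m) hu huv with h | h | ⟨X, rfl | rfl, h⟩
      exacts [.inr (.inl (.inr h)), .inr (.inr (.inl (.inr h))), .inl h, .inr (.inl (.inl h))]
  obtain ⟨D, hD, hDA, hDB, hDC, mCD⟩ := hD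
  have nbrC := @IsMixedTwoPartition.mem_of_adj V G P hP B C D hB hC hD hCB.symm hDC hDB.symm
    mBC.symm mCD
  by_cases leD : t ≤ D.ncard
  swap
  · refine .inr ⟨C, hC, G.commonNbrs B ∪ G.commonNbrs C ∪ D, B ∪ C,
      IsLinkedPath.ncard_union_lt hK leB leC (by omega), subset_rfl,
      fun a _ b hb _ => .inr (.inr (.inl hb.1)), ?_⟩
    rintro u (hu | hu) v huv
    · rcases nbrB hu huv with h | h | h | h
      exacts [.inl h, .inr (.inl (.inl h)), .inr (.inl (.inr h)), .inr (.inr (.inl (.inl h)))]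
    · rcases nbrC hu huv with h | h | h | h
      exacts [.inr (.inl (.inl h)), .inr (.inl (.inr h)), .inr (.inr (.inr h)),
        .inr (.inr (.inl (.inr h)))]
  by_cases conn : G.Conn t A B C D
  · exact .inl ⟨A, B, C, D, hA, hB, hC, hD, hAB, hCA.symm, hDA.symm, hCB.symm, hDB.symm, hDC.symm,
      leA, leB, leC, leD, mAB.1, mBC.1, mCD.1, conn⟩
  simp only [Conn] at conn
  push Not at conn
  -- All four parts are large, so only `Conn` can fail; its failure provides the closed set.
  obtain ⟨Z, U, hZ, hBZ, hCZ, hU, hAU, hcl, hno⟩ := conn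
  refine .inr ⟨C, hC, Z, U, hZ, hU.trans Set.sdiff_subset,
    fun a ha b hb hab => .inr (.inr (hAU a ha b ⟨.inl hb.1, hb.2⟩ hab)), fun u hu v huv => ?_⟩
  by_cases hvZ : v ∈ Z
  · exact .inr (.inr hvZ)
  rcases (hU hu).1 with hu' | hu'
  · rcases nbrB hu' huv with h | h | h | h
    exacts [.inl h, .inr (.inl (hcl u hu v ⟨.inl h, hvZ⟩ huv)),
      .inr (.inl (hcl u hu v ⟨.inr h, hvZ⟩ huv)), (hvZ (hBZ h)).elim]
  · rcases nbrC hu' huv with h | h | h | h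
    exacts [.inr (.inl (hcl u hu v ⟨.inl h, hvZ⟩ huv)),
      .inr (.inl (hcl u hu v ⟨.inr h, hvZ⟩ huv)), (hno u hu v ⟨h, hvZ⟩ huv).elim,
      (hvZ (hCZ h)).elim]

/-- A part that meets many rows gives rise to a linked path, provided that no part meets too many
columns. -/
lemma exists_isLinkedPath_of_hits (hP : G.IsMixedTwoPartition P) {ι κ : Type*} [Finite ι]
    [Finite κ] {R : ι → Set V} {Q : κ → Set V} (hR : Pairwise fun i j => Disjoint (R i) (R j))
    (hconn : ∀ i (W : Set V), (R i ∩ W).Nonempty →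
      (∀ u ∈ R i, ∀ v ∈ R i, G.Adj u v → u ∈ W → v ∈ W) → R i ⊆ W)
    (hRQ : ∀ i j, (R i ∩ Q j).Nonempty) (hκ : 91 * t ≤ Nat.card κ) {A : Set V} (hA : A ∈ P)
    (hAR : 9 * t ≤ (hits R A).ncard) (hPQ : ∀ X ∈ P, (hits Q X).ncard ≤ 18 * t) :
    ∃ A B C D, G.IsLinkedPath t P A B C D := by
  by_contra hnone
  have leA : t ≤ A.ncard := by
    have := ncard_hits_le hR A
    omega
  have hSA := ncard_commonNbrs_lt hK leA
  obtain ⟨B₁, hB₁, B₂, hB₂, hB⟩ : ∃ B₁ ∈ P, ∃ B₂ ∈ P, ∀ B ∈ P, B ≠ A → G.Mixed A B →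
      B = B₁ ∨ B = B₂ := by
    by_cases h1 : ∃ B₁ ∈ P, B₁ ≠ A ∧ G.Mixed A B₁
    · obtain ⟨B₁, hB₁, n1, m1⟩ := h1
      by_cases h2 : ∃ B₂ ∈ P, B₂ ≠ A ∧ G.Mixed A B₂ ∧ B₁ ≠ B₂
      · obtain ⟨B₂, hB₂, n2, m2, h12⟩ := h2
        refine ⟨B₁, hB₁, B₂, hB₂, fun B hB n m => ?_⟩
        rcases hP.le_two A hA B₁ hB₁ B₂ hB₂ B hB n1 n2 n m1 m2 m with h | h | h
        exacts [(h12 h).elim, .inl h.symm, .inr h.symm]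
      · push Not at h2
        exact ⟨B₁, hB₁, B₁, hB₁, fun B hB n m => .inl (h2 B hB n m).symm⟩
    · push Not at h1
      exact ⟨A, hA, A, hA, fun B hB n m => (h1 B hB n m).elim⟩
  obtain ⟨C₁, hC₁, Z₁, U₁, hZ₁, hU₁, hAU₁, hcl₁⟩ :=
    (exists_isLinkedPath_or_closed hK hP hA hB₁ leA).resolve_left hnone
  obtain ⟨C₂, hC₂, Z₂, U₂, hZ₂, hU₂, hAU₂, hcl₂⟩ :=
    (exists_isLinkedPath_or_closed hK hP hA hB₂ leA).resolve_left hnone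
  set Z := Z₁ ∪ Z₂ ∪ G.commonNbrs A with hZdef
  set W := A ∪ U₁ ∪ U₂ with hWdef
  -- `4 * t` for each of the two directions out of `A`, and `t` for the common neighbours of `A`.
  have hZ : Z.ncard < 9 * t := by
    have := Set.ncard_union_le (Z₁ ∪ Z₂) (G.commonNbrs A)
    have := Set.ncard_union_le Z₁ Z₂
    rw [hZdef]
    omega
  have hW : ∀ u ∈ W, u ∉ Z → ∀ v, v ∉ Z → G.Adj u v → v ∈ W := by
    rintro u ((hu | hu) | hu) huZ v hvZ huv <;>
      simp only [hZdef, Set.mem_union, not_or] at huZ hvZ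
    · rcases hP.mem_of_adj' (F := {B₁, B₂}) (fun X hX hXA m => hB X hX hXA m) hu huv
        with h | h | ⟨X, rfl | rfl, h⟩
      · exact .inl (.inl h)
      · exact (hvZ.2 h).elim
      · rcases hAU₁ u ⟨hu, huZ.1.1⟩ v ⟨h, hvZ.1.1⟩ huv with h | h | h
        exacts [.inl (.inl h), (hvZ.2 h).elim, .inl (.inr h)]
      · rcases hAU₂ u ⟨hu, huZ.1.2⟩ v ⟨h, hvZ.1.2⟩ huv with h | h | h
        exacts [.inl (.inl h), (hvZ.2 h).elim, .inr h]
    · rcases hcl₁ u hu v huv with h | h | h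
      exacts [.inl (.inl h), .inl (.inr h), (hvZ.1.1 h).elim]
    · rcases hcl₂ u hu v huv with h | h | h
      exacts [.inl (.inl h), .inr h, (hvZ.1.2 h).elim]
  -- Disjoint rows: fewer than `9 * t` of them meet `Z`.
  obtain ⟨i, hiA, hiZ⟩ : ∃ i ∈ hits R A, i ∉ hits R Z := by
    by_contra! h
    have h1 := Set.ncard_le_ncard (show hits R A ⊆ hits R Z from h)
    have h2 := ncard_hits_le hR Z
    omega
  have hi : ∀ v ∈ R i, v ∉ Z := fun v hv hvZ => hiZ ⟨v, hv, hvZ⟩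
  have hRW : R i ⊆ W := hconn i W (hiA.mono (Set.inter_subset_inter_right _
    (Set.subset_union_left.trans Set.subset_union_left)))
    fun u hu v hv huv huW => hW u huW (hi u hu) v (hi v hv) huv
  have hall : hits Q (A ∪ (B₁ ∪ C₁) ∪ (B₂ ∪ C₂)) = Set.univ := by
    refine Set.eq_univ_of_forall fun j => ?_
    obtain ⟨v, hvR, hvQ⟩ := hRQ i j
    refine ⟨v, hvQ, ?_⟩
    rcases hRW hvR with (h | h) | h
    exacts [.inl (.inl h), .inl (.inr (hU₁ h)), .inr (hU₂ h)]
  have ht := IsLinkedPath.pos_of_not_isContained hK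
  -- Five parts meet at most `5 * 18 * t = 90 * t` columns, against at least `91 * t`.
  have e0 := Set.ncard_univ κ
  rw [← hall] at e0
  have e1 := ncard_hits_union_le Q (A ∪ (B₁ ∪ C₁)) (B₂ ∪ C₂)
  have e2 := ncard_hits_union_le Q A (B₁ ∪ C₁)
  have e3 := ncard_hits_union_le Q B₁ C₁
  have e4 := ncard_hits_union_le Q B₂ C₂
  have := hPQ A hA
  have := hPQ _ hB₁
  have := hPQ _ hB₂
  have := hPQ _ hC₁
  have := hPQ _ hC₂
  omega

end SimpleGraph

/-! ### The contradiction for a sequence of partitions. -/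

namespace SimpleGraph

variable {V : Type*}

lemma Walk.support_subset_of_closed {G : SimpleGraph V} {W : Set V} :
    ∀ {u v : V} (p : G.Walk u v), (∃ x ∈ p.support, x ∈ W) →
      (∀ x ∈ p.support, ∀ y ∈ p.support, G.Adj x y → x ∈ W → y ∈ W) → ∀ x ∈ p.support, x ∈ W
  | _, _, .nil, ⟨x, hx, hxW⟩, _ => by
    intro y hy
    simp only [Walk.support_nil, List.mem_singleton] at hx hy
    rwa [hy, ← hx]
  | u, _, .cons (v := w) h p, ⟨x, hx, hxW⟩, hcl => by
    have hw : w ∈ p.support := p.start_mem_support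
    have hcl' : ∀ x ∈ p.support, ∀ y ∈ p.support, G.Adj x y → x ∈ W → y ∈ W := fun x hx y hy =>
      hcl x (by simp [hx]) y (by simp [hy])
    have hp : ∀ x ∈ p.support, x ∈ W := by
      refine p.support_subset_of_closed ?_ hcl'
      rcases List.mem_cons.1 (by simpa using hx) with rfl | hx
      · exact ⟨w, hw, hcl x (by simp) w (by simp [hw]) h hxW⟩
      · exact ⟨x, hx, hxW⟩
    intro y hy
    rcases List.mem_cons.1 (by simpa using hy) with rfl | hy
    · exact hcl w (by simp [hw]) y (by simp) h.symm (hp w hw)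
    · exact hp y hy

/-- Two crossing families of connected sets exclude a sequence of merges of mixed two-partitions. -/
theorem false_of_partition_sequence [Finite V] {G : SimpleGraph V} {t : ℕ}
    (hK : ¬ (completeBipartiteGraph (Fin t) (Fin t)).IsContained G) {ι κ : Type*} [Finite ι]
    [Finite κ] {R : ι → Set V} {Q : κ → Set V} (hR : Pairwise fun i j => Disjoint (R i) (R j))
    (hQ : Pairwise fun i j => Disjoint (Q i) (Q j))
    (hRconn : ∀ i (W : Set V), (R i ∩ W).Nonempty →
      (∀ u ∈ R i, ∀ v ∈ R i, G.Adj u v → u ∈ W → v ∈ W) → R i ⊆ W)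
    (hQconn : ∀ i (W : Set V), (Q i ∩ W).Nonempty →
      (∀ u ∈ Q i, ∀ v ∈ Q i, G.Adj u v → u ∈ W → v ∈ W) → Q i ⊆ W)
    (hRQ : ∀ i j, (R i ∩ Q j).Nonempty) (hι : 91 * t ≤ Nat.card ι) (hκ : 91 * t ≤ Nat.card κ)
    {n : ℕ} {P : ℕ → Set (Set V)} (hP : ∀ i ≤ n, G.IsMixedTwoPartition (P i))
    (hstep : ∀ i < n, IsMerge (P i) (P (i + 1))) (h0 : ∀ A ∈ P 0, A.Subsingleton)
    (hn : Set.univ ∈ P n) : False := by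
  classical
  have ht := IsLinkedPath.pos_of_not_isContained hK
  have hback : ∀ i ≤ n, ¬ ∃ A B C D, G.IsLinkedPath t (P i) A B C D := by
    intro i
    induction i with
    | zero =>
      rintro - ⟨A, B, C, D, h⟩
      exact h.not_of_subsingleton hK (h0 A h.memA) (h0 B h.memB)
    | succ i ih =>
      rintro hi ⟨A, B, C, D, h⟩
      exact ih (by omega) (h.exists_of_isMerge hK (hP _ hi) (hP _ (by omega)) (hstep i (by omega)))
  let Big (i : ℕ) : Prop := ∃ A ∈ P i, 9 * t ≤ (hits R A).ncard ∨ 9 * t ≤ (hits Q A).ncard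
  have hex : ∃ i, i ≤ n ∧ Big i := by
    refine ⟨n, le_rfl, Set.univ, hn, .inl ?_⟩
    have : Nonempty κ := by
      rw [← not_isEmpty_iff]
      intro h
      simp at hκ
      omega
    have e : hits R Set.univ = Set.univ := by
      refine Set.eq_univ_of_forall fun i => ?_
      obtain ⟨v, hv, -⟩ := hRQ i (Classical.arbitrary κ)
      exact ⟨v, hv, trivial⟩
    rw [e, Set.ncard_univ]
    omega
  obtain ⟨hi, A, hA, hbig⟩ := Nat.find_spec hex
  have hmin := fun m => @Nat.find_min _ _ hex m
  generalize Nat.find hex = i at hi hA hmin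
  -- Just before the first big part appears every part is below `9 * t`, and one merge at most
  -- doubles this.
  have hsmall : ∀ X ∈ P i, (hits R X).ncard ≤ 18 * t ∧ (hits Q X).ncard ≤ 18 * t := by
    intro X hX
    rcases i with - | i
    · have h1 := ncard_hits_le hR X
      have h2 := ncard_hits_le hQ X
      have h3 := Set.ncard_le_one_iff_subsingleton.2 (h0 X hX)
      omega
    · have hno : ∀ Y ∈ P i, (hits R Y).ncard < 9 * t ∧ (hits Q Y).ncard < 9 * t := by
        intro Y hY
        by_contra hcon
        refine hmin i (by omega) ⟨by omega, Y, hY, ?_⟩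
        omega
      obtain ⟨Y, hY, Y', hY', -, e⟩ := hstep i (by omega)
      rw [e] at hX
      rcases hX with rfl | hX
      · have h1 := ncard_hits_union_le R Y Y'
        have h2 := ncard_hits_union_le Q Y Y'
        have h3 := hno Y hY
        have h4 := hno Y' hY'
        omega
      · have := hno X hX.1
        omega
  rcases hbig with h | h
  · exact hback i hi (exists_isLinkedPath_of_hits hK (hP i hi) hR hRconn hRQ hκ hA h
      fun X hX => (hsmall X hX).2)
  · exact hback i hi (exists_isLinkedPath_of_hits hK (hP i hi) hQ hQconn
      (fun i j => by rw [Set.inter_comm]; exact hRQ j i) hι hA h fun X hX => (hsmall X hX).1)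

end SimpleGraph

/-! ### From contraction sequences to partitions. -/

namespace Trigraph

variable {V : Type*}

/-- `f` assigns to every vertex of `G` the name of the vertex of `T` it has been contracted into. -/
structure IsQuotientMap (G : SimpleGraph V) (T : Trigraph V) (f : V → V) : Prop where
  mem : ∀ v, f v ∈ T.verts
  surj : ∀ x ∈ T.verts, ∃ v, f v = x
  adj : ∀ u v, G.Adj u v → f u ≠ f v → T.graph.Adj (f u) (f v)
  black : ∀ u v, T.graph.Adj (f u) (f v) → ¬ T.red.Adj (f u) (f v) → G.Adj u v

/-- The set of fibres of a map. -/
def fibres (f : V → V) : Set (Set V) := Set.range fun v => f ⁻¹' {f v}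

lemma isQuotientMap_id (G : SimpleGraph V) : IsQuotientMap G (ofGraph G) id where
  mem _ := trivial
  surj x _ := ⟨x, rfl⟩
  adj _ _ h _ := h
  black _ _ h _ := h

/-- The effect of a contraction on names. -/
noncomputable def merge (f : V → V) (x₁ x₂ x₀ : V) (v : V) : V :=
  open Classical in if f v = x₁ ∨ f v = x₂ then x₀ else f v

lemma merge_of_mem {f : V → V} {x₁ x₂ x₀ v : V} (h : f v = x₁ ∨ f v = x₂) :
    merge f x₁ x₂ x₀ v = x₀ := if_pos h

lemma merge_of_not_mem {f : V → V} {x₁ x₂ x₀ v : V} (h : ¬ (f v = x₁ ∨ f v = x₂)) :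
    merge f x₁ x₂ x₀ v = f v := if_neg h

section Contraction

variable {G : SimpleGraph V} {T T' : Trigraph V} {f : V → V} {x₁ x₂ x₀ : V}

lemma IsQuotientMap.mem_diff (hf : IsQuotientMap G T f) {v : V} (h : ¬ (f v = x₁ ∨ f v = x₂)) :
    f v ∈ T.verts \ {x₁, x₂} := ⟨hf.mem v, by simpa using h⟩

lemma IsQuotientMap.contract_adj (hf : IsQuotientMap G T f)
    (h : IsContractionOf T T' x₁ x₂ x₀) {u v : V} (hu : f u = x₁ ∨ f u = x₂)
    (hv : ¬ (f v = x₁ ∨ f v = x₂)) (huv : G.Adj u v) : T'.graph.Adj x₀ (f v) := by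
  have hne : f u ≠ f v := fun e => hv (e ▸ hu)
  have hadj := hf.adj u v huv hne
  have : f v ∈ T'.graph.neighborSet x₀ := by
    rw [h.neighborSet_eq]
    refine ⟨?_, by simpa using hv⟩
    rcases hu with hu | hu <;> rw [hu] at hadj
    exacts [.inl hadj, .inr hadj]
  exact this

/-- A black edge at `x₀` avoids the symmetric difference and both red neighbourhoods, so it comes
from black edges at both `x₁` and `x₂`. -/
lemma IsQuotientMap.contract_black (hf : IsQuotientMap G T f)
    (h : IsContractionOf T T' x₁ x₂ x₀) {u v : V} (hu : f u = x₁ ∨ f u = x₂)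
    (hv : ¬ (f v = x₁ ∨ f v = x₂)) (hadj : T'.graph.Adj x₀ (f v))
    (hred : ¬ T'.red.Adj x₀ (f v)) : G.Adj u v := by
  have h1 : f v ∈ T'.graph.neighborSet x₀ := hadj
  have h2 : f v ∉ T'.red.neighborSet x₀ := hred
  rw [h.neighborSet_eq] at h1
  rw [h.redNeighborSet_eq] at h2
  have hv' : f v ∉ ({x₁, x₂} : Set V) := h1.2
  simp only [Set.mem_sdiff, hv', not_false_eq_true, and_true, Set.mem_union, Set.mem_symmDiff,
    SimpleGraph.mem_neighborSet, not_or] at h1 h2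
  refine hf.black u v ?_ ?_
  · rcases hu with hu | hu <;> rw [hu] <;> tauto
  · rcases hu with hu | hu <;> rw [hu] <;> tauto

lemma IsQuotientMap.contract (hf : IsQuotientMap G T f) (h : IsContractionOf T T' x₁ x₂ x₀) :
    IsQuotientMap G T' (merge f x₁ x₂ x₀) where
  mem v := by
    rw [h.verts_eq]
    by_cases hv : f v = x₁ ∨ f v = x₂
    · rw [merge_of_mem hv]; exact .inl rfl
    · rw [merge_of_not_mem hv]; exact .inr (hf.mem_diff hv)
  surj x hx := by
    rw [h.verts_eq] at hx
    rcases hx with rfl | ⟨hx, hx'⟩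
    · obtain ⟨v, hv⟩ := hf.surj x₁ h.left_mem
      exact ⟨v, merge_of_mem (.inl hv)⟩
    · obtain ⟨v, rfl⟩ := hf.surj x hx
      exact ⟨v, merge_of_not_mem (by simpa using hx')⟩
  adj u v huv hne := by
    by_cases hu : f u = x₁ ∨ f u = x₂ <;> by_cases hv : f v = x₁ ∨ f v = x₂
    · rw [merge_of_mem hu, merge_of_mem hv] at hne
      exact (hne rfl).elim
    · rw [merge_of_mem hu, merge_of_not_mem hv]
      exact hf.contract_adj h hu hv huv
    · rw [merge_of_not_mem hu, merge_of_mem hv]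
      exact (hf.contract_adj h hv hu huv.symm).symm
    · rw [merge_of_not_mem hu, merge_of_not_mem hv] at hne ⊢
      exact (h.adj_iff _ (hf.mem_diff hu) _ (hf.mem_diff hv)).2 (hf.adj u v huv hne)
  black u v hadj hred := by
    by_cases hu : f u = x₁ ∨ f u = x₂ <;> by_cases hv : f v = x₁ ∨ f v = x₂
    · rw [merge_of_mem hu, merge_of_mem hv] at hadj
      exact (hadj.ne rfl).elim
    · rw [merge_of_mem hu, merge_of_not_mem hv] at hadj hred
      exact hf.contract_black h hu hv hadj hred
    · rw [merge_of_not_mem hu, merge_of_mem hv] at hadj hred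
      exact (hf.contract_black h hv hu hadj.symm fun h => hred h.symm).symm
    · rw [merge_of_not_mem hu, merge_of_not_mem hv] at hadj hred
      rw [h.adj_iff _ (hf.mem_diff hu) _ (hf.mem_diff hv)] at hadj
      rw [h.red_adj_iff _ (hf.mem_diff hu) _ (hf.mem_diff hv)] at hred
      exact hf.black u v hadj hred

lemma IsQuotientMap.mem_fibres (hf : IsQuotientMap G T f) {x : V} (hx : x ∈ T.verts) :
    f ⁻¹' {x} ∈ fibres f := by
  obtain ⟨v, rfl⟩ := hf.surj x hx
  exact ⟨v, rfl⟩

lemma preimage_ne {x y v : V} (hv : f v = x) (hxy : x ≠ y) : f ⁻¹' {x} ≠ f ⁻¹' {y} := fun e =>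
  hxy (hv.symm.trans (e ▸ (show v ∈ f ⁻¹' {x} from hv) : v ∈ f ⁻¹' {y}))

lemma IsQuotientMap.isMerge (hf : IsQuotientMap G T f) (h : IsContractionOf T T' x₁ x₂ x₀) :
    SimpleGraph.IsMerge (fibres f) (fibres (merge f x₁ x₂ x₀)) := by
  obtain ⟨v₁, hv₁⟩ := hf.surj x₁ h.left_mem
  have key₁ : ∀ v, (f v = x₁ ∨ f v = x₂) →
      merge f x₁ x₂ x₀ ⁻¹' {merge f x₁ x₂ x₀ v} = f ⁻¹' {x₁} ∪ f ⁻¹' {x₂} := by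
    intro v hv
    rw [merge_of_mem hv]
    ext w
    by_cases hw : f w = x₁ ∨ f w = x₂
    · simp [merge_of_mem hw, hw]
    -- Freshness of `x₀` keeps the merged fibre from absorbing a third one.
    · have : f w ≠ x₀ := fun e => h.fresh (e ▸ hf.mem_diff hw)
      simp [merge_of_not_mem hw, hw, this]
  have key₂ : ∀ v, ¬ (f v = x₁ ∨ f v = x₂) →
      merge f x₁ x₂ x₀ ⁻¹' {merge f x₁ x₂ x₀ v} = f ⁻¹' {f v} := by
    intro v hv
    rw [merge_of_not_mem hv]
    ext w
    by_cases hw : f w = x₁ ∨ f w = x₂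
    · have h1 : x₀ ≠ f v := fun e => h.fresh (e ▸ hf.mem_diff hv)
      have h2 : f w ≠ f v := fun e => hv (e ▸ hw)
      simp [merge_of_mem hw, h1, h2]
    · simp [merge_of_not_mem hw]
  refine ⟨_, hf.mem_fibres h.left_mem, _, hf.mem_fibres h.right_mem, preimage_ne hv₁ h.ne, ?_⟩
  ext A
  constructor
  · rintro ⟨v, rfl⟩
    by_cases hv : f v = x₁ ∨ f v = x₂
    · exact .inl (key₁ v hv)
    · refine .inr ?_
      dsimp only
      rw [key₂ v hv]
      rw [not_or] at hv
      refine ⟨⟨v, rfl⟩, ?_⟩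
      rintro (e | e)
      exacts [preimage_ne rfl hv.1 e, preimage_ne rfl hv.2 e]
  · rintro (rfl | ⟨⟨v, rfl⟩, hA⟩)
    · exact ⟨v₁, key₁ v₁ (.inl hv₁)⟩
    · refine ⟨v, key₂ v ?_⟩
      rintro (e | e)
      · exact hA (.inl (by simp [e]))
      · exact hA (.inr (by simp [e]))

/-- Touching fibres have adjacent names, and a black edge would make the pair complete. -/
lemma IsQuotientMap.red_of_mixed (hf : IsQuotientMap G T f) {x y : V} (hxy : x ≠ y)
    (h : G.Mixed (f ⁻¹' {x}) (f ⁻¹' {y})) : y ∈ T.red.neighborSet x := by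
  obtain ⟨⟨u, rfl, v, rfl, huv⟩, u', hu', v', hv', hn⟩ := h
  by_contra hr
  refine hn (hf.black u' v' ?_ ?_) <;> rw [hu', hv']
  exacts [hf.adj u v huv hxy, hr]

lemma IsQuotientMap.isMixedTwoPartition (hf : IsQuotientMap G T f)
    (hr : ∀ x ∈ T.verts, (T.red.neighborSet x).encard ≤ 2) :
    G.IsMixedTwoPartition (fibres f) where
  disjoint := by
    rintro _ ⟨u, rfl⟩ _ ⟨v, rfl⟩ hne
    refine Set.disjoint_left.2 fun w hw hw' => hne ?_
    have h1 : f w = f u := hw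
    have h2 : f w = f v := hw'
    simp [← h1, ← h2]
  cover v := ⟨_, ⟨v, rfl⟩, rfl⟩
  le_two := by
    rintro _ ⟨a, rfl⟩ _ ⟨b, rfl⟩ _ ⟨c, rfl⟩ _ ⟨d, rfl⟩ hb hc hd mb mc md
    dsimp only at *
    by_contra! hne
    have ne : ∀ {u v : V}, f ⁻¹' {f u} ≠ f ⁻¹' {f v} → f u ≠ f v := fun h e => h (by rw [e])
    have hsub : ({f b, f c, f d} : Set V) ⊆ T.red.neighborSet (f a) := by
      rintro _ (rfl | rfl | rfl)
      exacts [hf.red_of_mixed (ne hb).symm mb, hf.red_of_mixed (ne hc).symm mc,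
        hf.red_of_mixed (ne hd).symm md]
    have h3 : ({f b, f c, f d} : Set V).encard = 3 :=
      Set.encard_eq_three.2 ⟨_, _, _, ne hne.1, ne hne.2.1, ne hne.2.2, rfl⟩
    have := (Set.encard_le_encard hsub).trans (hr _ (hf.mem a))
    rw [h3] at this
    exact absurd this (by decide)

end Contraction

/-- A contraction sequence of width at most two yields a sequence of mixed two-partitions. -/
lemma IsContractionSequence.exists_partitions {G : SimpleGraph V} {n : ℕ}
    {S : Fin (n + 1) → Trigraph V} (hS : IsContractionSequence (ofGraph G) S)
    (hw : width S < 3) :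
    ∃ P : ℕ → Set (Set V), (∀ i ≤ n, G.IsMixedTwoPartition (P i)) ∧
      (∀ i < n, SimpleGraph.IsMerge (P i) (P (i + 1))) ∧ (∀ A ∈ P 0, A.Subsingleton) ∧
      Set.univ ∈ P n := by
  have step : ∀ i : ℕ, ∃ x₁ x₂ x₀ : V, ∀ hi : i < n,
      IsContractionOf (S (Fin.castSucc ⟨i, hi⟩)) (S (Fin.succ ⟨i, hi⟩)) x₁ x₂ x₀ := by
    intro i
    by_cases hi : i < n
    · obtain ⟨x₁, x₂, x₀, h⟩ := hS.step ⟨i, hi⟩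
      exact ⟨x₁, x₂, x₀, fun _ => h⟩
    -- Beyond the sequence any vertex serves as a default value.
    · obtain ⟨x, -⟩ := hS.finish
      exact ⟨x, x, x, fun h => (hi h).elim⟩
  choose x₁ x₂ x₀ hx using step
  let f : ℕ → V → V := fun i => Nat.rec id (fun i g => merge g (x₁ i) (x₂ i) (x₀ i)) i
  have hf : ∀ i (hi : i < n + 1), IsQuotientMap G (S ⟨i, hi⟩) (f i) := by
    intro i
    induction i with
    | zero =>
      intro hi
      have := hS.start
      exact (show S ⟨0, hi⟩ = ofGraph G from this) ▸ isQuotientMap_id G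
    | succ i ih =>
      intro hi
      exact (ih (by omega)).contract (hx i (by omega))
  refine ⟨fun i => fibres (f i), fun i hi => ?_, fun i hi => ?_, ?_, ?_⟩
  · refine (hf i (by omega)).isMixedTwoPartition fun x hx => ?_
    have h1 : ((S ⟨i, by omega⟩).red.neighborSet x).encard ≤ width S :=
      le_iSup_of_le (⟨i, by omega⟩ : Fin (n + 1)) (le_iSup₂_of_le x hx le_rfl)
    exact Order.le_of_lt_succ (lt_of_le_of_lt h1 hw)
  · exact (hf i (by omega)).isMerge (hx i hi)
  · rintro _ ⟨v, rfl⟩ a ha b hb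
    exact (show a = v from ha).trans (show b = v from hb).symm
  · obtain ⟨x, hx⟩ := hS.finish
    have hfn := hf n (by omega)
    have hx' : x ∈ (S ⟨n, by omega⟩).verts := by
      rw [show (⟨n, by omega⟩ : Fin (n + 1)) = Fin.last n from rfl, hx]; rfl
    have : f n ⁻¹' {x} = Set.univ := by
      refine Set.eq_univ_of_forall fun v => ?_
      have := hfn.mem v
      rw [show (⟨n, by omega⟩ : Fin (n + 1)) = Fin.last n from rfl, hx] at this
      exact this
    rw [← this]
    exact hfn.mem_fibres hx'

end Trigraph

/-! ### Application to the rows and columns of the mesh. -/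

theorem mainTheorem2 {V : Type*} [Finite V] (G : SimpleGraph V) (t : ℕ)
    (hK : ¬ (completeBipartiteGraph (Fin t) (Fin t)).IsContained G)
    (hmesh : ∃ H : G.Subgraph, H.IsCubicMesh (16 * (13 * t) ^ 2)) :
    3 ≤ G.twinWidth := by
  by_contra! hlt
  simp only [SimpleGraph.twinWidth, Trigraph.twinWidth, iInf_lt_iff] at hlt
  obtain ⟨n, S, hS, hw⟩ := hlt
  obtain ⟨P, hP, hstep, h0, hn⟩ := hS.exists_partitions hw
  obtain ⟨H, -, -, a, b, c, d, R, Q, -, -, hR, hQ, -, -, -, hRQ⟩ := hmesh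
  have hcard : 91 * t ≤ Nat.card (Fin (16 * (13 * t) ^ 2)) := by
    rw [Nat.card_fin]
    -- `91 * t ≤ 2704 * t ^ 2`, from `t ≤ t ^ 2`.
    nlinarith [Nat.le_self_pow two_ne_zero t]
  refine SimpleGraph.false_of_partition_sequence hK (R := fun i => {v | v ∈ (R i).support})
    (Q := fun j => {v | v ∈ (Q j).support})
    (fun i j hij => Set.disjoint_left.2 fun v hi hj => hR i j hij hi hj)
    (fun i j hij => Set.disjoint_left.2 fun v hi hj => hQ i j hij hi hj)
    (fun i W hne hcl => (R i).support_subset_of_closed hne hcl)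
    (fun i W hne hcl => (Q i).support_subset_of_closed hne hcl)
    (fun i j => ?_) hcard hcard hP hstep h0 hn
  obtain ⟨u, v, p, -, hp⟩ := hRQ i j
  have hu : u ∈ ((R i).toSubgraph ⊓ (Q j).toSubgraph).verts := by
    rw [hp]
    simp
  exact ⟨u, by simpa using hu.1, by simpa using hu.2⟩
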